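/- **Model.** Time is slotted, $t=0,1,2,\dots$. There are $N$ independent two-state Markov channels with states ON ($=1$) and OFF ($=0$). Channel $n$ has transition probability matrix $(\mathsf P_{n,ij})_{i,j\in\{0,1\}}$ with $\mathsf P_{n,10}>0$ and $x_n:=\mathsf P_{n,01}+\mathsf P_{n,10}<1$; $\mathsf P^{(k)}_{n,ij}$ denotes its $k$-step transition probabilities. In every slot at most one channel is used, without knowledge of the current channel states; the state of the used channel is revealed by an ACK (ON) or NACK (OFF) at the end of the slot. Every user always has data to send. Let $\omega_n(t)$ be the conditional probability that channel $n$ is ON in slot $t$ given the past observations: $\omega_n(t+1)$ equals $\mathsf P_{n,11}$ (respectively $\mathsf P_{n,01}$) if channel $n$ was used in slot $t$ and an ACK (respectively a NACK) was received, and equals $\omega_n(t)\mathsf P_{n,11}+(1-\omega_n(t))\mathsf P_{n,01}$ if channel $n$ was not used in slot $t$. The initial channel states are independent, channel $n$ being ON with probability $\omega_n(0)$, where $\mathsf P^{(N)}_{n,01}\le\omega_n(0)\le 1$; this includes the stationary probability $\omega_n(0)=\mathsf P_{n,01}/x_n$. **Policies.** Let $\Phi$ be the set of nonzero vectors in $\{0,1\}^N$;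 channel $n$ is active in $\phi$ if $\phi_n=1$, and $M(\phi)$ is the number of active channels. A $\mathsf{RandRR}$ policy is given by a probability distribution $(\alpha_\phi)_{\phi\in\Phi\cup\{\mathbf 0\}}$. It proceeds in rounds. At the start of each round it draws $\phi$ with probability $\alpha_\phi$, independently of the past. If $\phi=\mathbf 0$, the round consists of one idle slot. If $\phi\in\Phi$, the active channels of $\phi$ are served once each, least recently used first (an arbitrary fixed order is used among channels never used before). On switching to active channel $n$ in slot $t$, with probability $\mathsf P^{(M(\phi))}_{n,01}/\omega_n(t)$ data packets are transmitted over channel $n$, one per slot, until a NACK is received; otherwise one dummy packet carrying no data is sent over channel $n$ for one slot. (Set $0/0:=0$.) Then the policy switches to the next active channel, or starts a new round if there is none left. The policy is *feasible* if $\mathsf P^{(M(\phi))}_{n,01}\le\omega_n(t)$ almost surely whenever it is about to switch to an active channel $n$. Let $y_n(t)\in\{0,1\}$ be the number of data packets delivered over channel $n$ in slot $t$ (it is $1$ exactly if a data packet is sent over channel $n$ and the channel is ON). The policy *achieves* the throughput vector $\lambda\in\mathbb R^N$ if $\lim_{t\to\infty}\frac1t\sum_{\tau=0}^{t-1}\mathbb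 E[y_n(\tau)]=\lambda_n$ for every $n$. **Region.** For $\phi\in\Phi$ define $\eta^{\phi}\in\mathbb R^N$ by $$\eta^{\phi}_n=\frac{\mathsf P_{n,01}\bigl(1-(1-x_n)^{M(\phi)}\bigr)/(x_n\mathsf P_{n,10})}{M(\phi)+\sum_{m:\phi_m=1}\mathsf P_{m,01}\bigl(1-(1-x_m)^{M(\phi)}\bigr)/(x_m\mathsf P_{m,10})}\ \text{ if }\phi_n=1,\qquad \eta^{\phi}_n=0\ \text{ if }\phi_n=0,$$ and let $$\Lambda_{\mathrm{int}}=\bigl\{\lambda\in\mathbb R^N:\ \mathbf 0\le\lambda\le\mu\ \text{ entrywise for some }\mu\in\mathrm{conv}\{\eta^{\phi}:\phi\in\Phi\}\bigr\}.$$ **Corollary 2.** For every $\lambda\in\Lambda_{\mathrm{int}}$ there is a $\mathsf{RandRR}$ policy, that is, a distribution $(\alpha_\phi)_{\phi\in\Phi\cup\{\mathbf 0\}}$, which is feasible and achieves the throughput vector $\lambda$, for all initial probabilities $\omega_n(0)$ as above and every initial order of the unused channels. -/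

import Mathlib

open Filter Topology
open scoped ENNReal

/-! Channel states are Booleans: `true` is ON (state `1`), `false` is OFF (state `0`).  Channel `n`
has the transition matrix `P n`, whose entry `P n i j` is the probability of moving from state `i`
to state `j` between consecutive slots. -/

namespace RandRR

noncomputable section

variable {N : ℕ}

/-- The transition matrices of the `N` channels. -/
abbrev Channels (N : ℕ) := Fin N → Matrix Bool Bool ℝ

/-- The standing assumptions on the channels: each `P n` is a transition probability matrix, an ON
channel can turn OFF, and each channel is positively correlated over time, that is,
`x n = P n 0 1 + P n 1 0 < 1`. -/
structure Admissible (P : Channels N) : Prop where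
  stochastic : ∀ n, P n ∈ Matrix.rowStochastic ℝ Bool
  on_off_pos : ∀ n, 0 < P n true false
  pos_corr : ∀ n, P n false true + P n true false < 1

/-- The `k`-step transition probability of channel `n` from state `i` to state `j`. -/
def kStep (P : Channels N) (n : Fin N) (k : ℕ) (i j : Bool) : ℝ := (P n ^ k) i j

/-! ### The region `Λ_int` -/

/-- `x n = P n 0 1 + P n 1 0`. -/
def xRate (P : Channels N) (n : Fin N) : ℝ := P n false true + P n true false

/-- `P n 0 1 * (1 - (1 - x n) ^ M) / (x n * P n 1 0)`. -/
def gain (P : Channels N) (M : ℕ) (n : Fin N) : ℝ :=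
  P n false true * (1 - (1 - xRate P n) ^ M) / (xRate P n * P n true false)

/-- The vector `η^φ`; the binary vector `φ` is given by the set of its active channels. -/
def eta (P : Channels N) (φ : Finset (Fin N)) : Fin N → ℝ := fun n =>
  if n ∈ φ then gain P φ.card n / ((φ.card : ℝ) + ∑ m ∈ φ, gain P φ.card m) else 0

/-- The region `Λ_int`. -/
def lambdaInt (P : Channels N) : Set (Fin N → ℝ) :=
  {lam | 0 ≤ lam ∧ ∃ μ ∈ convexHull ℝ {v | ∃ φ : Finset (Fin N), φ.Nonempty ∧ v = eta P φ}, lam ≤ μ}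

/-! ### Randomness -/

/-- A coin that shows `true` with probability `r` (and `false` with probability `1 - r`) for
`0 ≤ r ≤ 1`; other values of `r` are replaced by the nearest point of `[0, 1]`. -/
def coin (r : ℝ) : PMF Bool :=
  PMF.ofFintype (fun b => ENNReal.ofReal (if b then max 0 (min r 1) else 1 - max 0 (min r 1))) (by
    have h0 : (0 : ℝ) ≤ max 0 (min r 1) := le_max_left _ _
    have h1 : max 0 (min r 1) ≤ (1 : ℝ) := max_le zero_le_one (min_le_right _ _)
    rw [Fintype.sum_bool, ← ENNReal.ofReal_add (by simp) (by simp [h1])]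
    simp)

/-- Independent coins: coordinate `n` of the outcome is `true` with probability `r n`. -/
def coins (r : Fin N → ℝ) : PMF (Fin N → Bool) :=
  PMF.ofFintype (fun s => ∏ n, coin (r n) (s n)) (by
    have h : ∀ n, ∑ b, coin (r n) b = 1 := fun n => by
      rw [← tsum_fintype (L := .unconditional _)]; exact (coin (r n)).tsum_coe
    have := (Finset.prod_univ_sum (fun _ : Fin N => (Finset.univ : Finset Bool))
      (fun n b => coin (r n) b)).symm
    rw [Fintype.piFinset_univ] at this
    rw [this]
    exact Finset.prod_eq_one fun n _ => h n)

/-! ### The randomized round robin policies -/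

/-- Where the policy stands at the beginning of a slot. -/
inductive Phase (N : ℕ) where
  /-- The set of no active channels was picked: the system idles in this slot. -/
  | idle
  /-- In a round with `M` active channels, the policy switches to channel `n` in this slot; the
  channels `rest` are still to be served afterwards in the same round, in this order. -/
  | turn (M : ℕ) (n : Fin N) (rest : List (Fin N))
  /-- In a round with `M` active channels, the policy is transmitting packets over channel `n`, and
  no NACK has been received since it switched to `n`. -/
  | hold (M : ℕ) (n : Fin N) (rest : List (Fin N))

/-- What is done in one slot. -/
inductive Action (N : ℕ) where
  | idle
  /-- A dummy packet without information content is sent over channel `n`. -/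
  | dummy (n : Fin N)
  /-- A data packet is sent over channel `n`. -/
  | data (n : Fin N)

/-- The state of the controller. It does not contain the channel states. -/
structure Control (N : ℕ) where
  /-- The information state `ω`: `belief n` is the conditional probability that channel `n` is ON. -/
  belief : Fin N → ℝ
  /-- All channels, from the least recently used one to the most recently used one. -/
  order : List (Fin N)
  phase : Phase N

/-- Beginning of a round: pick a set `φ` of active channels with probability `α φ`. If it is empty,
idle for one slot. Otherwise serve its members once each, least recently used first. -/
def newRound (α : PMF (Finset (Fin N))) (order : List (Fin N)) : PMF (Phase N) :=
  α.map fun φ =>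
    match order.filter (fun n => decide (n ∈ φ)) with
    | [] => Phase.idle
    | n :: rest => Phase.turn φ.card n rest

/-- The service of a channel has ended and the channels `rest` remain to be served in the round:
switch to the next one, or start a new round if none is left. -/
def advance (α : PMF (Finset (Fin N))) (order : List (Fin N)) (M : ℕ) :
    List (Fin N) → PMF (Phase N)
  | [] => newRound α order
  | n :: rest => PMF.pure (Phase.turn M n rest)

/-- The (random) action in a slot. On switching to channel `n` in a round with `M` active channels,
start transmitting packets with probability `P_{n,01}^{(M)} / ω n`, and send one dummy packet
otherwise. -/
def act (P : Channels N) (c : Control N) : PMF (Action N) :=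
  match c.phase with
  | Phase.idle => PMF.pure Action.idle
  | Phase.turn M n _ =>
      (coin (kStep P n M false true / c.belief n)).map fun b =>
        if b then Action.data n else Action.dummy n
  | Phase.hold _ n _ => PMF.pure (Action.data n)

/-- The channel used by an action, if any. -/
def Action.channel : Action N → Option (Fin N)
  | Action.idle => none
  | Action.dummy n => some n
  | Action.data n => some n

/-- The ACK/NACK feedback at the end of a slot with channel states `s`: it is `some true` (ACK) or
`some false` (NACK) according to the state of the used channel, and `none` in an idle slot. -/
def Action.feedback (a : Action N) (s : Fin N → Bool) : Option Bool := a.channel.map s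

/-- One-slot evolution of the information state of channel `n`, given the used channel and the
feedback. -/
def nextBelief (P : Channels N) (ω : Fin N → ℝ) (a : Action N) (fb : Option Bool) : Fin N → ℝ :=
  fun n =>
    if a.channel = some n then
      (if fb = some true then P n true true else P n false true)
    else ω n * P n true true + (1 - ω n) * P n false true

/-- The used channel becomes the most recently used one. -/
def nextOrder (order : List (Fin N)) (a : Action N) : List (Fin N) :=
  match a.channel with
  | none => order
  | some n => order.erase n ++ [n]

/-- The (random) phase of the next slot; `order` is the already updated order. Transmission over
`n` continues exactly when a data packet was acknowledged. -/
def nextPhase (α : PMF (Finset (Fin N))) (order : List (Fin N)) :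
    Phase N → Action N → Option Bool → PMF (Phase N)
  | Phase.idle, _, _ => newRound α order
  | Phase.turn M n rest, Action.data _, some true => PMF.pure (Phase.hold M n rest)
  | Phase.turn M _ rest, _, _ => advance α order M rest
  | Phase.hold M n rest, Action.data _, some true => PMF.pure (Phase.hold M n rest)
  | Phase.hold M _ rest, _, _ => advance α order M rest

/-- The controller's update at the end of a slot: it sees only the action and the feedback. -/
def nextControl (P : Channels N) (α : PMF (Finset (Fin N))) (c : Control N) (a : Action N)
    (fb : Option Bool) : PMF (Control N) :=
  (nextPhase α (nextOrder c.order a) c.phase a fb).map fun ph =>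
    ⟨nextBelief P c.belief a fb, nextOrder c.order a, ph⟩

/-! ### The controlled process -/

/-- The joint law of the channel states and of the controller state in slot `t`, when the channels
evolve independently, channel `n` is initially ON with probability `ω₀ n`, `order₀` is the initial
order of the (not yet used) channels, and rounds are drawn according to `α`. -/
def law (P : Channels N) (α : PMF (Finset (Fin N))) (ω₀ : Fin N → ℝ) (order₀ : List (Fin N)) :
    ℕ → PMF ((Fin N → Bool) × Control N)
  | 0 => (coins ω₀).bind fun s => (newRound α order₀).map fun ph => (s, ⟨ω₀, order₀, ph⟩)
  | t + 1 => (law P α ω₀ order₀ t).bind fun x => (act P x.2).bind fun a =>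
      (nextControl P α x.2 a (a.feedback x.1)).bind fun c' =>
        (coins fun n => P n (x.1 n) true).map fun s' => (s', c')

/-- The joint law of the channel states and of the action in slot `t`. -/
def slotLaw (P : Channels N) (α : PMF (Finset (Fin N))) (ω₀ : Fin N → ℝ) (order₀ : List (Fin N))
    (t : ℕ) : PMF ((Fin N → Bool) × Action N) :=
  (law P α ω₀ order₀ t).bind fun x => (act P x.2).map fun a => (x.1, a)

/-- `y n`, the number of data packets of user `n` delivered in a slot: it is one if a data packet is
sent over channel `n` and the channel is ON, and zero otherwise. -/
def served (n : Fin N) (z : (Fin N → Bool) × Action N) : ℝ :=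
  match z.2 with
  | Action.data m => if m = n ∧ z.1 n = true then 1 else 0
  | _ => 0

/-- The expectation of `y n` in slot `t`. -/
def expServed (P : Channels N) (α : PMF (Finset (Fin N))) (ω₀ : Fin N → ℝ) (order₀ : List (Fin N))
    (n : Fin N) (t : ℕ) : ℝ :=
  ∑' z, (slotLaw P α ω₀ order₀ t z).toReal * served n z

/-- The policy is feasible: whenever it may switch to an active channel `n` in a round with `M`
active channels, `P_{n,01}^{(M)} ≤ ω n`, so that `P_{n,01}^{(M)} / ω n` is a probability. -/
def Feasible (P : Channels N) (α : PMF (Finset (Fin N))) (ω₀ : Fin N → ℝ)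
    (order₀ : List (Fin N)) : Prop :=
  ∀ t, ∀ x ∈ (law P α ω₀ order₀ t).support, ∀ M n rest,
    x.2.phase = Phase.turn M n rest → kStep P n M false true ≤ x.2.belief n

/-- The throughput vector of the policy exists and equals `lam`. -/
def HasThroughput (P : Channels N) (α : PMF (Finset (Fin N))) (ω₀ : Fin N → ℝ)
    (order₀ : List (Fin N)) (lam : Fin N → ℝ) : Prop :=
  ∀ n, Tendsto (fun t : ℕ => (1 / (t : ℝ)) * ∑ τ ∈ Finset.range t, expServed P α ω₀ order₀ n τ)
    atTop (𝓝 (lam n))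

end

end RandRR

namespace RandRR
noncomputable section
variable {N : ℕ}

/-! ### Transition probabilities -/

/-! The proof is a renewal-reward argument carried out with a bounded potential. The coin
`P₀₁^(M)/ω` cancels the belief: with it, the first packet over a channel is delivered with
probability exactly `P₀₁^(M)`, whatever the history. Later ACKs continue with probability `P₁₁`, so
serving a channel delivers `gain` packets on average. It uses one slot more than it delivers
packets, the extra slot being the NACK or the dummy.

It therefore suffices to choose the law of the rounds so that, for every user `n`, the mean number
of packets per round is `lam n` times the mean round length (`exists_round_distribution`). For a
vector below a mixture of the `η^φ`, the point is that the region is closed under shrinking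
coordinates. Dropping channels from a round raises the gain per switch of the remaining ones, since
`(1 - q^M)/M` decreases in `M`. Leftover time is spent in idle rounds.

Feasibility holds for any law of the rounds. When the policy switches to `n`, the other `M - 1`
active channels have all been used more recently or, if never used, come later in the order; with
positive correlation this gives `ω n ≥ P₀₁^(M)` (`Reachable`).

For the throughput, resampling the channel states from the beliefs leaves the law of the process
unchanged (`law_bind_resample`). This gives an exact Poisson equation (`potential_drift`), which
telescopes; the potential is bounded, so the error in the time average is `O(1/t)`. -/

theorem Admissible.nonneg {P : Channels N} (hP : Admissible P) (n : Fin N) (i j : Bool) :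
    0 ≤ P n i j :=
  Matrix.nonneg_of_mem_rowStochastic (hP.stochastic n)

theorem Admissible.row_sum {P : Channels N} (hP : Admissible P) (n : Fin N) (i : Bool) :
    P n i true + P n i false = 1 := by
  have := Matrix.sum_row_of_mem_rowStochastic (hP.stochastic n) i
  simpa using this

theorem Admissible.le_one {P : Channels N} (hP : Admissible P) (n : Fin N) (i : Bool) :
    P n i true ≤ 1 := by
  linarith [hP.row_sum n i, hP.nonneg n i false]

theorem Admissible.xRate_pos {P : Channels N} (hP : Admissible P) (n : Fin N) :
    0 < xRate P n :=
  add_pos_of_nonneg_of_pos (hP.nonneg n _ _) (hP.on_off_pos n)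

theorem kStep_zero (P : Channels N) (n : Fin N) : kStep P n 0 false true = 0 := by
  simp [kStep]

theorem kStep_succ {P : Channels N} (hP : Admissible P) (n : Fin N) (k : ℕ) :
    kStep P n (k + 1) false true =
      kStep P n k false true * P n true true + (1 - kStep P n k false true) * P n false true := by
  have h := Matrix.sum_row_of_mem_rowStochastic (pow_mem (hP.stochastic n) k) false
  rw [Fintype.sum_bool] at h
  simp only [kStep, pow_succ, Matrix.mul_apply, Fintype.sum_bool]
  rw [show (P n ^ k) false false = 1 - (P n ^ k) false true by linarith]

theorem kStep_formula {P : Channels N} (hP : Admissible P) (n : Fin N) (k : ℕ) :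
    kStep P n k false true = P n false true * (1 - (1 - xRate P n) ^ k) / xRate P n := by
  have hx := (hP.xRate_pos n).ne'
  induction k with
  | zero => simp [kStep_zero]
  | succ k ih =>
    have h11 : P n true true = 1 - xRate P n + P n false true := by
      have := hP.row_sum n true
      simp only [xRate]; linarith
    rw [kStep_succ hP, ih, h11]
    field_simp
    ring

/-- Positive correlation places `1 - x` in `[0, 1]`, so its powers decrease and the OFF-to-ON
probability climbs without oscillation. -/
theorem kStep_mono {P : Channels N} (hP : Admissible P) (n : Fin N) :
    Monotone fun k => kStep P n k false true := by
  intro a b hab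
  have hx := hP.xRate_pos n
  have h1 : xRate P n < 1 := hP.pos_corr n
  simp only [kStep_formula hP]
  have := pow_le_pow_of_le_one (by linarith : 0 ≤ 1 - xRate P n) (by linarith) hab
  have := hP.nonneg n false true
  gcongr

theorem kStep_nonneg {P : Channels N} (hP : Admissible P) (n : Fin N) (k : ℕ) :
    0 ≤ kStep P n k false true := by
  simpa [kStep_zero] using kStep_mono hP n (Nat.zero_le k)

/-- This exhibits the gain as a mean packet count: the first packet succeeds with probability
`P₀₁^(M)`, and a run of ACKs has geometric mean length `1 / P₁₀`. -/
theorem gain_eq_kStep_div {P : Channels N} (hP : Admissible P) (n : Fin N) (k : ℕ) :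
    gain P k n = kStep P n k false true / P n true false := by
  rw [gain, kStep_formula hP, div_div]

theorem gain_nonneg {P : Channels N} (hP : Admissible P) (n : Fin N) (k : ℕ) :
    0 ≤ gain P k n := by
  rw [gain_eq_kStep_div hP]
  exact div_nonneg (kStep_nonneg hP n k) (hP.on_off_pos n).le

/-! ### The region as a set of round weights -/

/-- The map `k ↦ 1 - q^k` is concave and vanishes at `0`, so its ratio to `k` decreases. -/
theorem mul_one_sub_pow_le {q : ℝ} (h0 : 0 ≤ q) (h1 : q ≤ 1) {a b : ℕ} (hab : a ≤ b) :
    a * (1 - q ^ b) ≤ b * (1 - q ^ a) := by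
  induction b, hab using Nat.le_induction with
  | base => rfl
  | succ b hab ih =>
    have hb : q ^ b ≤ q ^ a := pow_le_pow_of_le_one h0 h1 hab
    -- `1 - q^a` is `(1 - q)` times a sum of `a` powers of `q`, each at least `q^a`.
    have key : (a : ℝ) * (1 - q) * q ^ a ≤ 1 - q ^ a := by
      clear hab ih hb
      induction a with
      | zero => simp
      | succ a ih =>
        have : 0 ≤ q ^ a := pow_nonneg h0 a
        have h2 : q ^ (a + 1) ≤ q ^ a := pow_le_pow_of_le_one h0 h1 (Nat.le_succ a)
        have h3 : (a : ℝ) * (1 - q) * q ^ (a + 1) ≤ a * (1 - q) * q ^ a := by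
          have : (0 : ℝ) ≤ a * (1 - q) := mul_nonneg a.cast_nonneg (by linarith)
          gcongr
        have h4 : (1 - q) * q ^ (a + 1) ≤ (1 - q) * q ^ a :=
          mul_le_mul_of_nonneg_left h2 (by linarith)
        push_cast
        have : q ^ (a + 1) = q * q ^ a := pow_succ' q a
        linarith
    have h5 : (a : ℝ) * (1 - q) * q ^ b ≤ a * (1 - q) * q ^ a := by
      have : (0 : ℝ) ≤ a * (1 - q) := mul_nonneg a.cast_nonneg (by linarith)
      gcongr
    have : q ^ (b + 1) = q * q ^ b := pow_succ' q b
    push_cast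
    rw [this]
    linarith

/-- The gain of the channels of `φ` per channel switch. -/
def switchGain (P : Channels N) (φ : Finset (Fin N)) : Fin N → ℝ := fun n =>
  if n ∈ φ then gain P φ.card n / φ.card else 0

theorem switchGain_nonneg {P : Channels N} (hP : Admissible P) (φ : Finset (Fin N)) :
    0 ≤ switchGain P φ := by
  intro n
  simp only [switchGain, Pi.zero_apply]
  split_ifs
  · exact div_nonneg (gain_nonneg hP n _) (Nat.cast_nonneg _)
  · rfl

theorem switchGain_anti {P : Channels N} (hP : Admissible P) {φ ψ : Finset (Fin N)} (h : φ ⊆ ψ)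
    {n : Fin N} (hn : n ∈ φ) : switchGain P ψ n ≤ switchGain P φ n := by
  have hx := hP.xRate_pos n
  have h1 : xRate P n < 1 := hP.pos_corr n
  have hc : φ.card ≤ ψ.card := Finset.card_le_card h
  have hφ : 0 < φ.card := Finset.card_pos.2 ⟨n, hn⟩
  have hφ' : (0 : ℝ) < φ.card := by exact_mod_cast hφ
  have hψ' : (0 : ℝ) < ψ.card := by exact_mod_cast hφ.trans_le hc
  simp only [switchGain, hn, h hn, if_true]
  rw [div_le_div_iff₀ hψ' hφ', gain, gain]
  have key := mul_one_sub_pow_le (q := 1 - xRate P n) (by linarith) (by linarith) hc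
  have h0 : 0 ≤ P n false true / (xRate P n * P n true false) :=
    div_nonneg (hP.nonneg n _ _) (mul_pos hx (hP.on_off_pos n)).le
  have := mul_le_mul_of_nonneg_left key h0
  calc _ = P n false true / (xRate P n * P n true false)
            * (φ.card * (1 - (1 - xRate P n) ^ ψ.card)) := by ring
    _ ≤ _ := this
    _ = _ := by ring

/-- Mixtures of the vectors `switchGain P φ` with total weight at most one; the round `φ` is run at
frequency `a φ`. -/
def switchRegion (P : Channels N) : Set (Fin N → ℝ) :=
  {v | ∃ a : Finset (Fin N) → ℝ, (∀ φ, 0 ≤ a φ) ∧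
    (∀ n, ∑ φ, a φ * (if n ∈ φ then gain P φ.card n else 0) = v n) ∧ ∑ φ, a φ * φ.card ≤ 1}

theorem convex_switchRegion (P : Channels N) : Convex ℝ (switchRegion P) := by
  rintro u ⟨a, ha, hu, ha1⟩ v ⟨b, hb, hv, hb1⟩ s t hs ht hst
  refine ⟨fun φ => s * a φ + t * b φ, fun φ => add_nonneg (mul_nonneg hs (ha φ))
    (mul_nonneg ht (hb φ)), fun n => ?_, ?_⟩
  · simp only [add_mul, mul_assoc, Finset.sum_add_distrib, ← Finset.mul_sum, hu, hv]
    simp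
  · simp only [add_mul, mul_assoc, Finset.sum_add_distrib, ← Finset.mul_sum]
    nlinarith

theorem switchGain_mem_switchRegion (P : Channels N) (φ : Finset (Fin N)) :
    switchGain P φ ∈ switchRegion P := by
  refine ⟨fun ψ => if ψ = φ then (φ.card : ℝ)⁻¹ else 0, fun ψ => ?_, fun n => ?_, ?_⟩
  · dsimp only
    split_ifs <;> simp
  · simp only [ite_mul, zero_mul, Finset.sum_ite_eq', Finset.mem_univ, if_true, switchGain]
    split_ifs
    · rw [div_eq_inv_mul]
    · simp
  · simp only [ite_mul, zero_mul, Finset.sum_ite_eq', Finset.mem_univ, if_true]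
    exact inv_mul_le_one

/-- The box below `switchGain P φ` is the convex hull of its vertices, so by convexity only these
matter. A vertex supported on a proper subset of `φ` lies below the gain vector of that subset by
`switchGain_anti`, and strong induction applies. -/
theorem mem_switchRegion_of_le {P : Channels N} (hP : Admissible P) (φ : Finset (Fin N)) :
    ∀ v : Fin N → ℝ, 0 ≤ v → v ≤ switchGain P φ → v ∈ switchRegion P := by
  induction φ using Finset.strongInduction with
  | H φ ih =>
    intro v h0 h1
    have hv : v ∈ convexHull ℝ (Set.univ.pi fun n => {0, switchGain P φ n}) := by
      rw [convexHull_pi]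
      intro n _
      change v n ∈ convexHull ℝ {0, switchGain P φ n}
      rw [convexHull_pair, segment_eq_Icc (show (0 : ℝ) ≤ switchGain P φ n from switchGain_nonneg hP φ n)]
      exact ⟨h0 n, h1 n⟩
    refine convexHull_min ?_ (convex_switchRegion P) hv
    intro u hu
    have hu' : ∀ n, u n = 0 ∨ u n = switchGain P φ n := fun n => by simpa using hu n trivial
    by_cases hS : φ.filter (fun n => u n ≠ 0) = φ
    · have : u = switchGain P φ := by
        funext n
        by_cases hn : n ∈ φ
        · rw [← hS] at hn
          exact (hu' n).resolve_left (Finset.mem_filter.1 hn).2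
        · rcases hu' n with h | h
          · simp [h, switchGain, hn]
          · exact h
      rw [this]
      exact switchGain_mem_switchRegion P φ
    · refine ih _ (lt_of_le_of_ne (Finset.filter_subset _ _) hS) u (fun n => ?_) (fun n => ?_)
      · rcases hu' n with h | h
        · simp [h]
        · rw [h]; exact switchGain_nonneg hP φ n
      · by_cases hn : u n = 0
        · rw [hn]; exact switchGain_nonneg hP _ n
        · have h2 := (hu' n).resolve_left hn
          have hφ : n ∈ φ := by
            by_contra hc
            exact hn (by rw [h2]; simp [switchGain, hc])
          rw [h2]
          exact switchGain_anti hP (Finset.filter_subset _ _) (by simp [hφ, hn])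

/-- The rate vectors `v` for which the rounds `φ` can be run at frequencies `a φ`, with all slots
used for switching or for the packets of `v`. -/
def rateRegion (P : Channels N) : Set (Fin N → ℝ) :=
  {v | ∃ a : Finset (Fin N) → ℝ, (∀ φ, 0 ≤ a φ) ∧
    (∀ n, ∑ φ, a φ * (if n ∈ φ then gain P φ.card n else 0) = v n) ∧
    ∑ φ, a φ * φ.card + ∑ n, v n ≤ 1}

theorem convex_rateRegion (P : Channels N) : Convex ℝ (rateRegion P) := by
  rintro u ⟨a, ha, hu, ha1⟩ v ⟨b, hb, hv, hb1⟩ s t hs ht hst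
  refine ⟨fun φ => s * a φ + t * b φ, fun φ => add_nonneg (mul_nonneg hs (ha φ))
    (mul_nonneg ht (hb φ)), fun n => ?_, ?_⟩
  · simp only [add_mul, mul_assoc, Finset.sum_add_distrib, ← Finset.mul_sum, hu, hv]
    simp
  · simp only [add_mul, mul_assoc, Finset.sum_add_distrib, ← Finset.mul_sum, Pi.add_apply,
      Pi.smul_apply, smul_eq_mul]
    nlinarith

theorem eta_eq_switchGain_div (P : Channels N) (φ : Finset (Fin N)) (hφ : φ.Nonempty) (n : Fin N) :
    eta P φ n = switchGain P φ n / (1 + ∑ m, switchGain P φ m) := by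
  have hc : (φ.card : ℝ) ≠ 0 := by exact_mod_cast (Finset.card_pos.2 hφ).ne'
  have hs : ∑ m, switchGain P φ m = (∑ m ∈ φ, gain P φ.card m) / φ.card := by
    simp only [switchGain, Finset.sum_ite_mem, Finset.univ_inter, Finset.sum_div]
  rw [hs, eta, switchGain]
  split_ifs
  · rw [div_div, mul_add, mul_one, mul_div_cancel₀ _ hc]
  · simp

/-- Dividing the frequencies for `θ * switchGain` by the normalizer `D` of `η^φ` leaves room for
both switches and packets: they take at most `1/D` and `(D - 1)/D` of the slots. -/
theorem mul_eta_mem_rateRegion {P : Channels N} (hP : Admissible P) {θ : Fin N → ℝ}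
    (h0 : ∀ n, 0 ≤ θ n) (h1 : ∀ n, θ n ≤ 1) (φ : Finset (Fin N)) (hφ : φ.Nonempty) :
    (fun n => θ n * eta P φ n) ∈ rateRegion P := by
  have hg := switchGain_nonneg hP φ
  obtain ⟨a, ha, hav, ha1⟩ := mem_switchRegion_of_le hP φ (fun n => θ n * switchGain P φ n)
    (fun n => mul_nonneg (h0 n) (hg n)) (fun n => mul_le_of_le_one_left (hg n) (h1 n))
  set D := 1 + ∑ m, switchGain P φ m with hD
  have hDpos : 0 < D := by
    have : 0 ≤ ∑ m, switchGain P φ m := Finset.sum_nonneg fun m _ => hg m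
    linarith
  refine ⟨fun ψ => a ψ / D, fun ψ => div_nonneg (ha ψ) hDpos.le, fun n => ?_, ?_⟩
  · simp only [div_mul_eq_mul_div, ← Finset.sum_div, hav, eta_eq_switchGain_div P φ hφ, ← hD]
    ring
  · simp only [div_mul_eq_mul_div, ← Finset.sum_div, eta_eq_switchGain_div P φ hφ, ← hD,
      ← mul_div_assoc]
    rw [← add_div, div_le_one hDpos]
    have : ∑ n, θ n * switchGain P φ n ≤ ∑ n, switchGain P φ n :=
      Finset.sum_le_sum fun n _ => mul_le_of_le_one_left (hg n) (h1 n)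
    linarith

theorem lambdaInt_subset_rateRegion {P : Channels N} (hP : Admissible P) :
    lambdaInt P ⊆ rateRegion P := by
  rintro lam ⟨h0, μ, hμ, hle⟩
  -- Where `μ n = 0`, also `lam n = 0`, so the value `θ n = 0` given by division by zero is
  -- harmless.
  let θ : Fin N → ℝ := fun n => lam n / μ n
  have hμ0 : ∀ n, 0 ≤ μ n := fun n => (h0 n).trans (hle n)
  have hθ : lam = fun n => θ n * μ n := by
    funext n
    rcases (hμ0 n).eq_or_lt with h | h
    · have h2 := h0 n
      have h3 := hle n
      rw [← h] at h3 ⊢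
      simpa using le_antisymm h3 h2
    · simp [θ, h.ne']
  -- Scaling by `θ` is linear, so the preimage of the convex `rateRegion` is convex and it is enough
  -- to test the points `η^φ`.
  have hconv : Convex ℝ {u : Fin N → ℝ | (fun n => θ n * u n) ∈ rateRegion P} := by
    intro u hu v hv s t hs ht hst
    have := convex_rateRegion P hu hv hs ht hst
    simp only [Set.mem_ofPred_eq]
    convert this using 1
    funext n
    simp only [Pi.add_apply, Pi.smul_apply, smul_eq_mul]
    ring
  rw [hθ]
  refine convexHull_min ?_ hconv hμ
  rintro _ ⟨φ, hφ, rfl⟩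
  exact mul_eta_mem_rateRegion hP (fun n => div_nonneg (h0 n) (hμ0 n))
    (fun n => div_le_one_of_le₀ (hle n) (hμ0 n)) φ hφ

/-- The potential gained while channel `k` is served in a round with `M` active channels, when user
`n` is served at rate `r`: the expected number of packets of user `n`, minus `r` times the expected
number of slots used. -/
def turnValue (P : Channels N) (n : Fin N) (r : ℝ) (M : ℕ) (k : Fin N) : ℝ :=
  (if k = n then gain P M k else 0) - r * (1 + gain P M k)

/-- The potential gained in a round on the set `φ`; a round on `∅` is one idle slot. -/
def roundValue (P : Channels N) (n : Fin N) (r : ℝ) (φ : Finset (Fin N)) : ℝ :=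
  if φ = ∅ then -r
  else ∑ k ∈ φ, turnValue P n r φ.card k

/-- The equation is the renewal-reward balance for each user. The frequencies of `rateRegion` are
per slot; after the unused time goes to idle rounds, normalizing them gives a law per round. -/
theorem exists_round_distribution {P : Channels N} (hP : Admissible P) {lam : Fin N → ℝ}
    (hlam : lam ∈ lambdaInt P) :
    ∃ α : PMF (Finset (Fin N)), ∀ n,
      ∑ φ, (α φ).toReal * roundValue P n (lam n) φ = 0 := by
  obtain ⟨a, ha, hv, ha1⟩ := lambdaInt_subset_rateRegion hP hlam
  set e : ℝ := 1 - (∑ φ, a φ * φ.card + ∑ n, lam n) with he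
  have he0 : 0 ≤ e := by linarith
  -- The empty round contributes neither packets nor switches, so its weight can be replaced by the
  -- slack `e`.
  let b : Finset (Fin N) → ℝ := fun φ => if φ = ∅ then e else a φ
  have hb : ∀ φ, 0 ≤ b φ := fun φ => by simp only [b]; split_ifs; exacts [he0, ha φ]
  have hbv : ∀ n, ∑ φ, b φ * (if n ∈ φ then gain P φ.card n else 0) = lam n := fun n => by
    rw [← hv n]
    refine Finset.sum_congr rfl fun φ _ => ?_
    by_cases hφ : φ = ∅ <;> simp [b, hφ]
  have hbc : ∑ φ, b φ * φ.card = ∑ φ, a φ * φ.card := by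
    refine Finset.sum_congr rfl fun φ _ => ?_
    by_cases hφ : φ = ∅ <;> simp [b, hφ]
  set B := ∑ φ, b φ with hB
  -- If all weights vanished, no slot would carry a switch or a packet, forcing `e = 1`.
  have hB0 : 0 < B := by
    refine lt_of_le_of_ne (Finset.sum_nonneg fun φ _ => hb φ) fun h0 => ?_
    have hz : ∀ φ, b φ = 0 := fun φ =>
      (Finset.sum_eq_zero_iff_of_nonneg fun φ _ => hb φ).1 h0.symm φ (Finset.mem_univ _)
    have h1 : ∀ n, lam n = 0 := fun n => by rw [← hbv n]; simp [hz]
    have h2 : ∑ φ, a φ * (φ.card : ℝ) = 0 := by rw [← hbc]; simp [hz]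
    have h3 : e = 0 := by simpa [b] using hz ∅
    rw [h2] at he
    simp [h1, h3] at he
  refine ⟨PMF.ofFintype (fun φ => ENNReal.ofReal (b φ / B)) ?_, fun n => ?_⟩
  · rw [← ENNReal.ofReal_sum_of_nonneg fun φ _ => div_nonneg (hb φ) hB0.le, ← Finset.sum_div,
      div_self hB0.ne', ENNReal.ofReal_one]
  · have hval : ∀ φ, roundValue P n (lam n) φ = (if n ∈ φ then gain P φ.card n else 0)
        - lam n * (φ.card + ∑ k, if k ∈ φ then gain P φ.card k else 0)
        - lam n * (if φ = ∅ then 1 else 0) := fun φ => by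
      by_cases hφ : φ = ∅
      · simp [hφ, roundValue]
      · simp only [roundValue, turnValue, hφ, if_false, Finset.sum_sub_distrib, ← Finset.mul_sum,
          Finset.sum_add_distrib, Finset.sum_ite_eq', Finset.sum_ite_mem, Finset.univ_inter]
        simp
    simp only [PMF.ofFintype_apply, ENNReal.toReal_ofReal (div_nonneg (hb _) hB0.le),
      div_mul_eq_mul_div, ← Finset.sum_div]
    refine div_eq_zero_iff.2 (Or.inl ?_)
    have hsum : ∑ φ, b φ * ∑ k, (if k ∈ φ then gain P φ.card k else 0) = ∑ k, lam k := by
      simp only [Finset.mul_sum]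
      rw [Finset.sum_comm]
      exact Finset.sum_congr rfl fun k _ => hbv k
    calc ∑ φ, b φ * roundValue P n (lam n) φ
        = ∑ φ, b φ * (if n ∈ φ then gain P φ.card n else 0)
          - lam n * (∑ φ, b φ * φ.card + ∑ φ, b φ * ∑ k, if k ∈ φ then gain P φ.card k else 0)
          - lam n * ∑ φ, b φ * (if φ = ∅ then 1 else 0) := by
            simp only [hval, Finset.mul_sum, ← Finset.sum_sub_distrib, ← Finset.sum_add_distrib,
              mul_sub, mul_add]
            refine Finset.sum_congr rfl fun φ _ => ?_
            simp only [mul_left_comm]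
      _ = 0 := by
            rw [hbv, hbc, hsum]
            simp only [mul_ite, mul_one, mul_zero, Finset.sum_ite_eq', Finset.mem_univ, if_true]
            simp only [b, if_true, he]
            ring

/-! ### The invariant of the controller -/

/-- The channels still to be served in a round, followed by those already served, appear in this
sequence in the order of usage; the held channel is known to have been ON in the last slot. -/
def PhaseOK (P : Channels N) (ω : Fin N → ℝ) (order : List (Fin N)) : Phase N → Prop
  | Phase.idle => True
  | Phase.turn M n rest => ∃ done, (n :: rest ++ done).Sublist order ∧ (n :: rest ++ done).length = M
  | Phase.hold M n rest => ω n = P n true true ∧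
      ∃ done, (rest ++ (done ++ [n])).Sublist order ∧ (rest ++ (done ++ [n])).length = M

/-- An invariant of the controller: a channel followed by `k` others in the order of usage was not
used in the last `k` slots, which bounds its belief from below. -/
structure Reachable (P : Channels N) (c : Control N) : Prop where
  nonneg : ∀ n, 0 ≤ c.belief n
  le_one : ∀ n, c.belief n ≤ 1
  nodup : c.order.Nodup
  mem_order : ∀ n, n ∈ c.order
  kStep_le : ∀ n l, (n :: l).Sublist c.order → kStep P n (l.length + 1) false true ≤ c.belief n
  phaseOK : PhaseOK P c.belief c.order c.phase

theorem length_filter_eq_card {order : List (Fin N)} (hnd : order.Nodup) (hmem : ∀ n, n ∈ order)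
    (φ : Finset (Fin N)) : (order.filter fun n => decide (n ∈ φ)).length = φ.card := by
  rw [← List.toFinset_card_of_nodup (hnd.filter _)]
  congr 1
  ext n
  simp [hmem]

theorem phaseOK_newRound {P : Channels N} {α : PMF (Finset (Fin N))} {ω : Fin N → ℝ}
    {order : List (Fin N)} (hnd : order.Nodup) (hmem : ∀ n, n ∈ order) {ph : Phase N}
    (h : ph ∈ (newRound α order).support) : PhaseOK P ω order ph := by
  rw [newRound, PMF.support_map] at h
  obtain ⟨φ, -, rfl⟩ := h
  have hl := length_filter_eq_card hnd hmem φ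
  have hs : (order.filter fun n => decide (n ∈ φ)).Sublist order := List.filter_sublist
  dsimp only
  cases hf : order.filter (fun n => decide (n ∈ φ)) with
  | nil => trivial
  | cons n rest =>
    rw [hf] at hl hs
    exact ⟨[], by simpa using hs, by simpa using hl⟩

theorem phaseOK_advance {P : Channels N} {α : PMF (Finset (Fin N))} {ω : Fin N → ℝ}
    {order : List (Fin N)} (hnd : order.Nodup) (hmem : ∀ n, n ∈ order) {M : ℕ}
    {rest done : List (Fin N)} (hs : (rest ++ done).Sublist order)
    (hl : (rest ++ done).length = M) {ph : Phase N}
    (h : ph ∈ (advance α order M rest).support) : PhaseOK P ω order ph := by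
  cases rest with
  | nil => exact phaseOK_newRound hnd hmem h
  | cons n rest =>
    rw [advance, PMF.mem_support_pure_iff] at h
    subst h
    exact ⟨done, hs, hl⟩

/-- The channel served in a phase. -/
def Phase.channel : Phase N → Option (Fin N)
  | Phase.idle => none
  | Phase.turn _ n _ => some n
  | Phase.hold _ n _ => some n

theorem channel_of_mem_support_act {P : Channels N} {c : Control N} {a : Action N}
    (h : a ∈ (act P c).support) : a.channel = c.phase.channel := by
  rw [act] at h
  split at h
  · rename_i hph
    rw [PMF.mem_support_pure_iff] at h
    simp [h, hph, Action.channel, Phase.channel]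
  · rename_i hph
    rw [PMF.support_map] at h
    obtain ⟨b, -, rfl⟩ := h
    cases b <;> simp [hph, Action.channel, Phase.channel]
  · rename_i hph
    rw [PMF.mem_support_pure_iff] at h
    simp [h, hph, Action.channel, Phase.channel]

theorem sublist_nextOrder_of_cons {order l : List (Fin N)} {n : Fin N}
    (h : (n :: l).Sublist order) : (l ++ [n]).Sublist (order.erase n ++ [n]) := by
  have := h.erase n
  rw [List.erase_cons_head] at this
  exact this.append_right _

theorem sublist_nextOrder_of_append {order l : List (Fin N)} {n : Fin N} (hnd : order.Nodup)
    (h : (l ++ [n]).Sublist order) : (l ++ [n]).Sublist (order.erase n ++ [n]) := by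
  have h1 : (l ++ [n]).Nodup := hnd.sublist h
  have h2 : n ∉ l := fun hn => by
    rw [List.nodup_append] at h1
    exact h1.2.2 n hn n (by simp) rfl
  have := h.erase n
  rw [List.erase_append_right _ h2, List.erase_cons_head, List.append_nil] at this
  exact this.append_right _

theorem nodup_nextOrder {order : List (Fin N)} (h : order.Nodup) (a : Action N) :
    (nextOrder order a).Nodup := by
  rw [nextOrder]
  split
  · exact h
  · rename_i n _
    rw [List.nodup_append]
    refine ⟨h.erase n, by simp, ?_⟩
    rintro x hx y hy rfl
    rw [List.mem_singleton] at hy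
    subst hy
    exact (h.not_mem_erase) hx

theorem mem_nextOrder {order : List (Fin N)} (hmem : ∀ n, n ∈ order) (a : Action N) (n : Fin N) :
    n ∈ nextOrder order a := by
  rw [nextOrder]
  split
  · exact hmem n
  · rename_i m _
    by_cases h : n = m
    · simp [h]
    · simp [List.mem_erase_of_ne h, hmem n]

/-- Using a channel removes it from the order and appends it, so the followers of another channel
grow by at most one per slot, matching one more step of its belief towards stationarity. -/
theorem Reachable.next {P : Channels N} (hP : Admissible P) {α : PMF (Finset (Fin N))}
    {c : Control N} (hc : Reachable P c) {a : Action N} (ha : a ∈ (act P c).support)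
    {fb : Option Bool} {c' : Control N} (hc' : c' ∈ (nextControl P α c a fb).support) :
    Reachable P c' := by
  have hch := channel_of_mem_support_act ha
  rw [nextControl, PMF.support_map] at hc'
  obtain ⟨ph, hph, rfl⟩ := hc'
  have hnd := nodup_nextOrder hc.nodup a
  have hmem := mem_nextOrder hc.mem_order a
  -- The one-slot belief map has slope `P₁₁ - P₀₁ = 1 - x > 0`.
  have hT : ∀ n, ∀ p q : ℝ, p ≤ q → p * P n true true + (1 - p) * P n false true ≤
      q * P n true true + (1 - q) * P n false true := fun n p q hpq => by
    have h1 := hP.row_sum n true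
    have h2 := hP.pos_corr n
    nlinarith
  refine ⟨fun n => ?_, fun n => ?_, hnd, hmem, fun n l hl => ?_, ?_⟩
  · simp only [nextBelief]
    have h1 := hP.nonneg n true true
    have h0 := hP.nonneg n false true
    split_ifs
    · exact h1
    · exact h0
    · exact add_nonneg (mul_nonneg (hc.nonneg n) h1)
        (mul_nonneg (sub_nonneg.2 (hc.le_one n)) h0)
  · simp only [nextBelief]
    have h1 := hP.le_one n true
    have h0 := hP.le_one n false
    split_ifs
    · exact h1
    · exact h0
    · nlinarith [hc.nonneg n, hc.le_one n]
  · simp only [nextBelief] at hl ⊢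
    have key : ∀ k, kStep P n (k + 1) false true ≤ c.belief n → l.length ≤ k + 1 →
        kStep P n (l.length + 1) false true ≤
          c.belief n * P n true true + (1 - c.belief n) * P n false true := fun k hk hlk => by
      refine (kStep_mono hP n (Nat.succ_le_succ hlk)).trans ?_
      simp only [Nat.succ_eq_add_one]
      rw [kStep_succ hP]
      exact hT n _ _ hk
    cases hm : a.channel with
    | none =>
      simp only [nextOrder, hm] at hl
      simp only [reduceCtorEq, if_false]
      exact key l.length (hc.kStep_le n l hl) (Nat.le_succ _)
    | some m =>
      simp only [nextOrder, hm] at hl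
      by_cases hnm : m = n
      · subst hnm
        -- The channel just used is last in the order, so nothing follows it; the bound to prove is
        -- `P₀₁`, which is at most `P₁₁` in the ACK case.
        have hl0 : l = [] := by
          obtain ⟨l₁, l₂, h12, h1, h2⟩ := List.sublist_append_iff.1 hl
          cases l₁ with
          | nil =>
            have := h2.length_le
            rw [List.nil_append] at h12
            rw [← h12] at this
            exact List.length_eq_zero_iff.1 (by simpa using this)
          | cons x l₁ =>
            have hx : m = x := by simpa using (List.cons.inj h12).1
            subst hx
            exact absurd (h1.subset (by simp)) hc.nodup.not_mem_erase
        subst hl0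
        have h01 : kStep P m ([] : List (Fin N)).length.succ false true = P m false true := by
          simp [kStep]
        rw [← Nat.succ_eq_add_one, h01]
        simp only [if_true]
        split_ifs
        · have h1 := hP.row_sum m true
          have h2 := hP.pos_corr m
          linarith
        · rfl
      · have hne : ¬ (some m = some n) := by simpa using hnm
        rw [if_neg hne]
        -- Erasing the used channel shortens the list of followers by at most one and yields a
        -- sublist of the old order.
        have h := hl.erase m
        have hm' : m ∉ c.order.erase m := hc.nodup.not_mem_erase
        rw [List.erase_append_right _ hm', List.erase_cons_head, List.append_nil,
          List.erase_cons_tail (by simpa using Ne.symm hnm)] at h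
        refine key (l.erase m).length (hc.kStep_le n _ (h.trans List.erase_sublist)) ?_
        rw [List.length_erase]
        split_ifs <;> omega
  · have hok := hc.phaseOK
    cases hcp : c.phase with
    | idle =>
      rw [hcp] at hph
      exact phaseOK_newRound hnd hmem hph
    | turn M n rest =>
      rw [hcp] at hph hok hch
      obtain ⟨done, hs, hl⟩ := hok
      have hord : nextOrder c.order a = c.order.erase n ++ [n] := by
        simp [nextOrder, hch, Phase.channel]
      have hs' : (rest ++ (done ++ [n])).Sublist (nextOrder c.order a) := by
        rw [hord, ← List.append_assoc]
        exact sublist_nextOrder_of_cons hs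
      have hl' : (rest ++ (done ++ [n])).length = M := by
        rw [← hl]; simp; omega
      rw [nextPhase.eq_def] at hph
      split at hph
      · simp_all
      · rename_i heq
        cases heq
        rw [PMF.mem_support_pure_iff] at hph
        subst hph
        refine ⟨?_, done, hs', hl'⟩
        simp [nextBelief, hch, Phase.channel]
      · rename_i heq _
        cases heq
        exact phaseOK_advance hnd hmem hs' hl' hph
      · simp_all
      · simp_all
    | hold M n rest =>
      rw [hcp] at hph hok hch
      obtain ⟨-, done, hs, hl⟩ := hok
      have hord : nextOrder c.order a = c.order.erase n ++ [n] := by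
        simp [nextOrder, hch, Phase.channel]
      have hs' : (rest ++ (done ++ [n])).Sublist (nextOrder c.order a) := by
        rw [hord, ← List.append_assoc]
        exact sublist_nextOrder_of_append hc.nodup (by rwa [List.append_assoc])
      rw [nextPhase.eq_def] at hph
      split at hph
      · simp_all
      · simp_all
      · simp_all
      · rename_i heq
        cases heq
        rw [PMF.mem_support_pure_iff] at hph
        subst hph
        refine ⟨?_, done, hs', hl⟩
        simp [nextBelief, hch, Phase.channel]
      · rename_i heq _
        cases heq
        exact phaseOK_advance hnd hmem hs' hl hph

theorem reachable_of_mem_support_law {P : Channels N} (hP : Admissible P)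
    (α : PMF (Finset (Fin N))) {ω₀ : Fin N → ℝ}
    (hω : ∀ n, kStep P n N false true ≤ ω₀ n ∧ ω₀ n ≤ 1) {order₀ : List (Fin N)}
    (hnd : order₀.Nodup) (hmem : ∀ n, n ∈ order₀) (t : ℕ) :
    ∀ x ∈ (law P α ω₀ order₀ t).support, Reachable P x.2 := by
  induction t with
  | zero =>
    intro x hx
    simp only [law, PMF.support_bind, PMF.support_map, Set.mem_iUnion, Set.mem_image] at hx
    obtain ⟨s, -, ph, hph, rfl⟩ := hx
    refine ⟨fun n => (kStep_nonneg hP n N).trans (hω n).1, fun n => (hω n).2, hnd, hmem,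
      -- A duplicate-free list of channels has length at most `N`, so the initial bound by the
      -- `N`-step probability covers every case.
      fun n l hl => (kStep_mono hP n ?_).trans (hω n).1, phaseOK_newRound hnd hmem hph⟩
    have h1 := (hnd.sublist hl).length_le_card
    simpa using h1
  | succ t ih =>
    intro x hx
    simp only [law, PMF.support_bind, PMF.support_map, Set.mem_iUnion, Set.mem_image] at hx
    obtain ⟨y, hy, a, ha, c', hc', s', -, rfl⟩ := hx
    exact (ih y hy).next hP ha hc'

/-- The unserved active channels follow `n` by the serving order, and the served ones were moved to
the end: `M - 1` followers in total. -/
theorem Reachable.kStep_le_of_turn {P : Channels N} {c : Control N} (hc : Reachable P c) {M : ℕ}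
    {n : Fin N} {rest : List (Fin N)} (h : c.phase = Phase.turn M n rest) :
    kStep P n M false true ≤ c.belief n := by
  have hok := hc.phaseOK
  rw [h] at hok
  obtain ⟨done, hs, hl⟩ := hok
  have := hc.kStep_le n (rest ++ done) hs
  rwa [show (rest ++ done).length + 1 = M by rw [← hl]; simp] at this

/-! ### Expectations under finitely supported laws -/

section Expect

variable {β γ : Type*}

/-- The expectation of `f` under `p`. -/
def expect (p : PMF β) (f : β → ℝ) : ℝ := ∑' z, (p z).toReal * f z

theorem expect_eq_sum {p : PMF β} (f : β → ℝ) {S : Finset β} (hS : p.support ⊆ S) :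
    expect p f = ∑ z ∈ S, (p z).toReal * f z := by
  refine tsum_eq_sum fun z hz => ?_
  have : p z = 0 := by
    by_contra h
    exact hz (hS ((PMF.mem_support_iff p z).2 h))
  simp [this]

theorem expect_fintype [Fintype β] (p : PMF β) (f : β → ℝ) :
    expect p f = ∑ z, (p z).toReal * f z :=
  expect_eq_sum f (by simp)

theorem expect_pure (b : β) (f : β → ℝ) : expect (PMF.pure b) f = f b := by
  classical
  rw [expect_eq_sum (S := {b}) f (by simp)]
  simp

/-- Finite supports reduce this to exchanging finite sums, with no summability conditions. -/
theorem expect_bind {p : PMF β} {q : β → PMF γ} (hp : p.support.Finite)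
    (hq : ∀ x, (q x).support.Finite) (f : γ → ℝ) :
    expect (p.bind q) f = expect p fun x => expect (q x) f := by
  classical
  have hT : (⋃ x ∈ p.support, (q x).support).Finite := hp.biUnion fun x _ => hq x
  have hsub : ∀ x ∈ p.support, (q x).support ⊆ (hT.toFinset : Set γ) := fun x hx => by
    rw [Set.Finite.coe_toFinset]
    exact Set.subset_biUnion_of_mem (u := fun x => (q x).support) hx
  rw [expect_eq_sum (S := hT.toFinset) f (by
      rw [PMF.support_bind, Set.Finite.coe_toFinset]),
    expect_eq_sum (S := hp.toFinset) _ (by simp)]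
  have h1 : ∀ z, (p.bind q z).toReal = ∑ x ∈ hp.toFinset, (p x).toReal * (q x z).toReal := by
    intro z
    rw [PMF.bind_apply, tsum_eq_sum (s := hp.toFinset), ENNReal.toReal_sum]
    · simp only [ENNReal.toReal_mul]
    · exact fun x _ => ENNReal.mul_ne_top (p.apply_ne_top x) ((q x).apply_ne_top z)
    · intro x hx
      have : p x = 0 := by
        by_contra h
        exact hx (by simpa using h)
      simp [this]
  simp only [h1, Finset.sum_mul]
  rw [Finset.sum_comm]
  refine Finset.sum_congr rfl fun x hx => ?_
  rw [expect_eq_sum f (hsub x (by simpa using hx)), Finset.mul_sum]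
  simp only [mul_assoc]

theorem expect_map {p : PMF β} (g : β → γ) (hp : p.support.Finite) (f : γ → ℝ) :
    expect (p.map g) f = expect p fun x => f (g x) := by
  rw [← PMF.bind_pure_comp, expect_bind hp fun x => by simp]
  simp [expect_pure]

theorem expect_congr {p : PMF β} {f g : β → ℝ} (h : ∀ x ∈ p.support, f x = g x) :
    expect p f = expect p g := by
  refine tsum_congr fun z => ?_
  by_cases hz : p z = 0
  · simp [hz]
  · rw [h z ((PMF.mem_support_iff p z).2 hz)]

theorem expect_add {p : PMF β} (hp : p.support.Finite) (f g : β → ℝ) :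
    expect p (fun x => f x + g x) = expect p f + expect p g := by
  have hS : p.support ⊆ (hp.toFinset : Set β) := by simp
  simp only [expect_eq_sum _ hS, mul_add, Finset.sum_add_distrib]

theorem sum_toReal_eq_one {p : PMF β} (hp : p.support.Finite) :
    ∑ z ∈ hp.toFinset, (p z).toReal = 1 := by
  rw [← ENNReal.toReal_sum fun z _ => p.apply_ne_top z]
  have : ∑ z ∈ hp.toFinset, p z = 1 := by
    rw [← p.tsum_coe]
    refine (tsum_eq_sum fun z hz => ?_).symm
    by_contra h
    exact hz (by simpa using h)
  rw [this, ENNReal.toReal_one]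

theorem expect_const {p : PMF β} (hp : p.support.Finite) (r : ℝ) :
    expect p (fun _ => r) = r := by
  have hS : p.support ⊆ (hp.toFinset : Set β) := by simp
  rw [expect_eq_sum _ hS, ← Finset.sum_mul, sum_toReal_eq_one, one_mul]

theorem abs_expect_le {p : PMF β} (hp : p.support.Finite) {f : β → ℝ} {C : ℝ}
    (h : ∀ x ∈ p.support, |f x| ≤ C) : |expect p f| ≤ C := by
  have hS : p.support ⊆ (hp.toFinset : Set β) := by simp
  rw [expect_eq_sum _ hS]
  refine (Finset.abs_sum_le_sum_abs _ _).trans ?_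
  calc ∑ z ∈ hp.toFinset, |(p z).toReal * f z| ≤ ∑ z ∈ hp.toFinset, (p z).toReal * C := by
        refine Finset.sum_le_sum fun z hz => ?_
        rw [abs_mul, abs_of_nonneg ENNReal.toReal_nonneg]
        exact mul_le_mul_of_nonneg_left (h z (by simpa using hz)) ENNReal.toReal_nonneg
    _ = C := by rw [← Finset.sum_mul, sum_toReal_eq_one, one_mul]

theorem finite_support_bind {p : PMF β} {q : β → PMF γ} (hp : p.support.Finite)
    (hq : ∀ x, (q x).support.Finite) : (p.bind q).support.Finite := by
  rw [PMF.support_bind]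
  exact hp.biUnion fun x _ => hq x

theorem finite_support_map {p : PMF β} (g : β → γ) (hp : p.support.Finite) :
    (p.map g).support.Finite := by
  rw [PMF.support_map]
  exact hp.image g

theorem finite_support_pure (b : β) : (PMF.pure b).support.Finite := by simp

end Expect

/-! ### Coins -/

theorem coin_toReal {r : ℝ} (h0 : 0 ≤ r) (h1 : r ≤ 1) (b : Bool) :
    (coin r b).toReal = if b then r else 1 - r := by
  rw [coin, PMF.ofFintype_apply, min_eq_left h1, max_eq_right h0, ENNReal.toReal_ofReal]
  split_ifs <;> linarith

theorem sum_coin (r : ℝ) : ∑ b, coin r b = 1 := by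
  rw [← tsum_fintype (L := .unconditional _)]
  exact (coin r).tsum_coe

theorem expect_coin {r : ℝ} (h0 : 0 ≤ r) (h1 : r ≤ 1) (f : Bool → ℝ) :
    expect (coin r) f = r * f true + (1 - r) * f false := by
  rw [expect_fintype, Fintype.sum_bool, coin_toReal h0 h1, coin_toReal h0 h1]
  simp

theorem coins_apply (r : Fin N → ℝ) (s : Fin N → Bool) : coins r s = ∏ n, coin (r n) (s n) :=
  PMF.ofFintype_apply _ _

/-- Mixing two coins. -/
theorem sum_coin_mul_coin {r p q : ℝ} (hr0 : 0 ≤ r) (hr1 : r ≤ 1) (hp0 : 0 ≤ p) (hp1 : p ≤ 1)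
    (hq0 : 0 ≤ q) (hq1 : q ≤ 1) (b' : Bool) :
    ∑ b, coin r b * coin (if b then p else q) b' = coin (r * p + (1 - r) * q) b' := by
  have h0 : 0 ≤ r * p + (1 - r) * q :=
    add_nonneg (mul_nonneg hr0 hp0) (mul_nonneg (sub_nonneg.2 hr1) hq0)
  have h1 : r * p + (1 - r) * q ≤ 1 := by nlinarith
  have hne : ∀ b, coin r b * coin (if b then p else q) b' ≠ ⊤ := fun b =>
    ENNReal.mul_ne_top ((coin _).apply_ne_top _) ((coin _).apply_ne_top _)
  rw [← ENNReal.toReal_eq_toReal_iff' (ENNReal.sum_ne_top.2 fun b _ => hne b)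
    ((coin _).apply_ne_top _), Fintype.sum_bool, ENNReal.toReal_add (hne _) (hne _),
    ENNReal.toReal_mul, ENNReal.toReal_mul]
  simp only [if_true, Bool.false_eq_true, if_false]
  rw [coin_toReal h0 h1, coin_toReal hr0 hr1, coin_toReal hr0 hr1, coin_toReal hp0 hp1,
    coin_toReal hq0 hq1]
  cases b'
  · simp
    ring
  · simp

/-- Marginal of one of several independent coins. -/
theorem map_coins (r : Fin N → ℝ) (m : Fin N) : (coins r).map (fun s => s m) = coin (r m) := by
  classical
  ext b
  rw [PMF.map_apply, tsum_fintype]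
  trans ∑ s : Fin N → Bool,
    ∏ n, coin (r n) (s n) * (if n = m then (if b = s n then 1 else 0) else 1)
  · refine Finset.sum_congr rfl fun s _ => ?_
    rw [Finset.prod_mul_distrib, coins_apply, Finset.prod_ite_eq' Finset.univ m]
    by_cases h : b = s m <;> simp [h]
  rw [← Fintype.piFinset_univ, ← Finset.prod_univ_sum (fun _ : Fin N => (Finset.univ : Finset Bool))
    (fun n c => coin (r n) c * (if n = m then (if b = c then 1 else 0) else 1)),
    Finset.prod_eq_single m]
  · simp
  · intro n _ hn
    simp only [hn, if_false, mul_one, sum_coin]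
  · simp

/-- The law of the feedback and of the next channel states, when the channel states have the law
given by the beliefs: conditionally on the feedback, the next states have the law given by the
updated beliefs. -/
theorem feedback_states_law {P : Channels N} (hP : Admissible P) {ω : Fin N → ℝ}
    (h0 : ∀ n, 0 ≤ ω n) (h1 : ∀ n, ω n ≤ 1) (a : Action N) :
    ((coins ω).bind fun s => (coins fun n => P n (s n) true).map fun s' => (a.feedback s, s')) =
      (coins ω).bind fun s => (coins (nextBelief P ω a (a.feedback s))).map
        fun s' => (a.feedback s, s') := by
  classical
  have hmap : ∀ (r : Fin N → ℝ) (x y : Option Bool) (s' : Fin N → Bool),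
      ((coins r).map fun s' => (x, s')) (y, s') = if y = x then coins r s' else 0 := by
    intro r x y s'
    rw [PMF.map_apply, tsum_fintype]
    by_cases h : y = x <;> simp [h, Finset.sum_ite_eq]
  have hmix : ∀ n b', ∑ b, coin (ω n) b * coin (P n b true) b' =
      coin (ω n * P n true true + (1 - ω n) * P n false true) b' := fun n b' => by
    rw [← sum_coin_mul_coin (h0 n) (h1 n) (hP.nonneg n true true) (hP.le_one n true)
      (hP.nonneg n false true) (hP.le_one n false)]
    simp
  ext ⟨y, s'⟩
  rw [PMF.bind_apply, PMF.bind_apply, tsum_fintype, tsum_fintype]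
  simp only [hmap]
  cases hm : a.channel with
  | none =>
    have hfb : ∀ s, a.feedback s = none := fun s => by simp [Action.feedback, hm]
    simp only [hfb]
    by_cases hy : y = none
    · simp only [hy, if_true]
      rw [← Finset.sum_mul]
      have hone : ∑ s, coins ω s = 1 := by
        rw [← tsum_fintype (L := .unconditional _)]; exact (coins ω).tsum_coe
      rw [hone, one_mul, coins_apply]
      have hb : ∀ n, nextBelief P ω a none n = ω n * P n true true + (1 - ω n) * P n false true :=
        fun n => by simp [nextBelief, hm]
      simp only [hb, ← hmix, coins_apply, ← Finset.prod_mul_distrib]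
      rw [Finset.prod_univ_sum, Fintype.piFinset_univ]
    · simp [hy]
  | some m =>
    have hfb : ∀ s, a.feedback s = some (s m) := fun s => by simp [Action.feedback, hm]
    simp only [hfb]
    cases y with
    | none => simp
    | some b =>
      simp only [Option.some.injEq]
      -- The feedback event only concerns coordinate `m`. Written as one more factor of the product,
      -- it lets the sum over `s` split channel by channel.
      have hL : ∀ s : Fin N → Bool,
          (coins ω s * if b = s m then coins (fun n => P n (s n) true) s' else 0) =
          ∏ n, coin (ω n) (s n) * coin (P n (s n) true) (s' n) *
            (if n = m then (if b = s n then 1 else 0) else 1) := fun s => by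
        rw [Finset.prod_mul_distrib, Finset.prod_mul_distrib, coins_apply, coins_apply,
          Finset.prod_ite_eq' Finset.univ m]
        simp
      have hR : ∀ s : Fin N → Bool,
          (coins ω s * if b = s m then coins (nextBelief P ω a (some (s m))) s' else 0) =
          ((coins ω s) * (if b = s m then 1 else 0)) * coins (nextBelief P ω a (some b)) s' :=
        fun s => by
          by_cases h : b = s m <;> simp [h]
      have hM : ∑ s, coins ω s * (if b = s m then 1 else 0) = coin (ω m) b := by
        rw [← map_coins ω m, PMF.map_apply, tsum_fintype]
        refine Finset.sum_congr rfl fun s _ => ?_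
        by_cases h : b = s m <;> simp [h]
      simp only [hL, hR]
      rw [← Finset.sum_mul, hM, ← Fintype.piFinset_univ,
        ← Finset.prod_univ_sum (fun _ : Fin N => (Finset.univ : Finset Bool)) (fun n c =>
          coin (ω n) c * coin (P n c true) (s' n) * (if n = m then (if b = c then 1 else 0) else 1)),
        coins_apply, ← Finset.mul_prod_erase _ _ (Finset.mem_univ m),
        ← Finset.mul_prod_erase Finset.univ (fun n => coin (nextBelief P ω a (some b) n) (s' n))
          (Finset.mem_univ m), ← mul_assoc]
      congr 1
      · cases b <;> simp [nextBelief, hm]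
      · refine Finset.prod_congr rfl fun n hn => ?_
        have hne : n ≠ m := (Finset.mem_erase.1 hn).1
        have hne' : ¬ (some m = some n) := by simpa using hne.symm
        simp only [hne, if_false, mul_one, hmix, nextBelief, hm, if_neg hne']

/-! ### The beliefs are conditional probabilities -/

/-- Draw the channel states according to the beliefs of the controller. -/
def resample (c : Control N) : PMF ((Fin N → Bool) × Control N) :=
  (coins c.belief).map fun s => (s, c)

/-- The controller sees the channels only through the feedback, so `feedback_states_law` can be
pushed through its update; the new belief does not depend on the random phase. -/
theorem nextControl_resample {P : Channels N} (hP : Admissible P) (α : PMF (Finset (Fin N)))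
    {c : Control N} (h0 : ∀ n, 0 ≤ c.belief n) (h1 : ∀ n, c.belief n ≤ 1) (a : Action N) :
    ((coins c.belief).bind fun s => (nextControl P α c a (a.feedback s)).bind fun c' =>
        (coins fun n => P n (s n) true).map fun s' => (s', c')) =
      (coins c.belief).bind fun s => (nextControl P α c a (a.feedback s)).bind resample := by
  have key := congrArg (fun p => p.bind fun z : Option Bool × (Fin N → Bool) =>
    (nextControl P α c a z.1).map fun c' => (z.2, c')) (feedback_states_law hP h0 h1 a)
  simp only [PMF.bind_bind, PMF.bind_map] at key
  have hL : ∀ s : Fin N → Bool,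
      ((nextControl P α c a (a.feedback s)).bind fun c' =>
        (coins fun n => P n (s n) true).map fun s' => (s', c')) =
      (coins fun n => P n (s n) true).bind ((fun z : Option Bool × (Fin N → Bool) =>
        (nextControl P α c a z.1).map fun c' => (z.2, c')) ∘ fun s' => (a.feedback s, s')) := by
    intro s
    simp only [← PMF.bind_pure_comp]
    rw [PMF.bind_comm]
    rfl
  have hR : ∀ s : Fin N → Bool,
      ((nextControl P α c a (a.feedback s)).bind resample) =
      (coins (nextBelief P c.belief a (a.feedback s))).bind
        ((fun z : Option Bool × (Fin N → Bool) =>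
        (nextControl P α c a z.1).map fun c' => (z.2, c')) ∘ fun s' => (a.feedback s, s')) := by
    intro s
    simp only [nextControl, PMF.bind_map, PMF.map_comp, Function.comp_def, resample]
    simp only [← PMF.bind_pure_comp]
    rw [PMF.bind_comm]
    rfl
  simp only [hL, hR]
  exact key

theorem bind_congr_support {β γ : Type*} {p : PMF β} {f g : β → PMF γ}
    (h : ∀ x ∈ p.support, f x = g x) : p.bind f = p.bind g := by
  ext z
  rw [PMF.bind_apply, PMF.bind_apply]
  refine tsum_congr fun x => ?_
  by_cases hx : p x = 0
  · simp [hx]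
  · rw [h x ((PMF.mem_support_iff p x).2 hx)]

/-- The transition kernel of the controlled process. -/
def step (P : Channels N) (α : PMF (Finset (Fin N))) (x : (Fin N → Bool) × Control N) :
    PMF ((Fin N → Bool) × Control N) :=
  (act P x.2).bind fun a => (nextControl P α x.2 a (a.feedback x.1)).bind fun c' =>
    (coins fun n => P n (x.1 n) true).map fun s' => (s', c')

/-- After the step, the law is a mixture of laws `resample c'`, and resampling is idempotent. -/
theorem resample_bind_step {P : Channels N} (hP : Admissible P) (α : PMF (Finset (Fin N)))
    {c : Control N} (h0 : ∀ n, 0 ≤ c.belief n) (h1 : ∀ n, c.belief n ≤ 1) :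
    ((resample c).bind (step P α)).bind (fun x => resample x.2) = (resample c).bind (step P α) := by
  have hs : (resample c).bind (step P α) = (act P c).bind fun a =>
      (coins c.belief).bind fun s => (nextControl P α c a (a.feedback s)).bind resample := by
    simp only [resample, PMF.bind_map, Function.comp_def, step]
    rw [PMF.bind_comm]
    congr 1
    funext a
    exact nextControl_resample hP α h0 h1 a
  have hr : ∀ c' : Control N, ((resample c').bind fun x => resample x.2) = resample c' := by
    intro c'
    rw [resample, PMF.bind_map]
    change ((coins c'.belief).bind fun _ => resample c') = _
    rw [PMF.bind_const, resample]
  rw [hs]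
  simp only [PMF.bind_bind, hr]

/-- Given the controller state, the channels are independent and ON with probabilities equal to the
beliefs; invariance under resampling expresses this without conditioning. -/
theorem law_bind_resample {P : Channels N} (hP : Admissible P) (α : PMF (Finset (Fin N)))
    {ω₀ : Fin N → ℝ} {order₀ : List (Fin N)}
    (hreach : ∀ t, ∀ x ∈ (law P α ω₀ order₀ t).support, Reachable P x.2) (t : ℕ) :
    (law P α ω₀ order₀ t).bind (fun x => resample x.2) = law P α ω₀ order₀ t := by
  induction t with
  | zero =>
    simp only [law, PMF.bind_bind, PMF.bind_map, Function.comp_def, resample]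
    rw [PMF.bind_const]
    simp only [← PMF.bind_pure_comp]
    rw [PMF.bind_comm]
    rfl
  | succ t ih =>
    have h : law P α ω₀ order₀ (t + 1) =
        (law P α ω₀ order₀ t).bind fun x => (resample x.2).bind (step P α) := by
      conv_lhs => rw [law, ← ih]
      rw [PMF.bind_bind]
      rfl
    rw [h, PMF.bind_bind]
    exact bind_congr_support fun x hx =>
      resample_bind_step hP α (hreach t x hx).nonneg (hreach t x hx).le_one

/-! ### Finite supports -/

theorem finite_support_newRound (α : PMF (Finset (Fin N))) (order : List (Fin N)) :
    (newRound α order).support.Finite :=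
  finite_support_map _ (Set.toFinite _)

theorem finite_support_advance (α : PMF (Finset (Fin N))) (order : List (Fin N)) (M : ℕ)
    (rest : List (Fin N)) : (advance α order M rest).support.Finite := by
  cases rest with
  | nil => exact finite_support_newRound α order
  | cons n rest => exact finite_support_pure _

theorem finite_support_nextPhase (α : PMF (Finset (Fin N))) (order : List (Fin N)) (ph : Phase N)
    (a : Action N) (fb : Option Bool) : (nextPhase α order ph a fb).support.Finite := by
  rw [nextPhase.eq_def]
  split
  · exact finite_support_newRound α order
  · exact finite_support_pure _
  · exact finite_support_advance _ _ _ _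
  · exact finite_support_pure _
  · exact finite_support_advance _ _ _ _

theorem finite_support_act (P : Channels N) (c : Control N) : (act P c).support.Finite := by
  rw [act]
  split
  · exact finite_support_pure _
  · exact finite_support_map _ (Set.toFinite _)
  · exact finite_support_pure _

theorem finite_support_nextControl (P : Channels N) (α : PMF (Finset (Fin N))) (c : Control N)
    (a : Action N) (fb : Option Bool) : (nextControl P α c a fb).support.Finite :=
  finite_support_map _ (finite_support_nextPhase _ _ _ _ _)

theorem finite_support_coins (r : Fin N → ℝ) : (coins r).support.Finite := Set.toFinite _

theorem finite_support_step (P : Channels N) (α : PMF (Finset (Fin N)))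
    (x : (Fin N → Bool) × Control N) : (step P α x).support.Finite :=
  finite_support_bind (finite_support_act P _) fun _ =>
    finite_support_bind (finite_support_nextControl _ _ _ _ _) fun _ =>
      finite_support_map _ (finite_support_coins _)

theorem finite_support_law (P : Channels N) (α : PMF (Finset (Fin N))) (ω₀ : Fin N → ℝ)
    (order₀ : List (Fin N)) (t : ℕ) : (law P α ω₀ order₀ t).support.Finite := by
  induction t with
  | zero =>
    exact finite_support_bind (finite_support_coins _) fun _ =>
      finite_support_map _ (finite_support_newRound _ _)
  | succ t ih => exact finite_support_bind ih (finite_support_step P α)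

/-! ### The potential -/

/-- The potential still to be gained when the channels `rest` remain to be served. -/
def restValue (P : Channels N) (n : Fin N) (r : ℝ) (M : ℕ) (rest : List (Fin N)) : ℝ :=
  (rest.map (turnValue P n r M)).sum

/-- The expected number of packets of user `n` until the end of the round, minus `r` times the
expected number of slots until then. -/
def potential (P : Channels N) (n : Fin N) (r : ℝ) : Phase N → ℝ
  | Phase.idle => -r
  | Phase.turn M m rest => restValue P n r M (m :: rest)
  | Phase.hold M m rest =>
      ((if m = n then P m true true else 0) - r) / P m true false + restValue P n r M rest

theorem expect_newRound {P : Channels N} {n : Fin N} {r : ℝ} {α : PMF (Finset (Fin N))}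
    (hα : ∑ φ, (α φ).toReal * roundValue P n r φ = 0) {order : List (Fin N)}
    (hnd : order.Nodup) (hmem : ∀ n, n ∈ order) :
    expect (newRound α order) (potential P n r) = 0 := by
  rw [newRound, expect_map _ (Set.toFinite _), expect_fintype, ← hα]
  refine Finset.sum_congr rfl fun φ _ => ?_
  congr 1
  have hsum : ((order.filter fun k => decide (k ∈ φ)).map (turnValue P n r φ.card)).sum =
      ∑ k ∈ φ, turnValue P n r φ.card k := by
    rw [← List.sum_toFinset _ (hnd.filter _)]
    congr 1
    ext k
    simp [hmem]
  have hlen := length_filter_eq_card hnd hmem φ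
  cases hf : order.filter (fun k => decide (k ∈ φ)) with
  | nil =>
    rw [hf] at hlen
    have hφ : φ = ∅ := Finset.card_eq_zero.1 hlen.symm
    simp [potential, roundValue, hφ]
  | cons k rest =>
    rw [hf] at hlen hsum
    have hφ : φ ≠ ∅ := fun h => by simp [h] at hlen
    simp only [potential, roundValue, restValue, hφ, if_false, hsum]

theorem expect_advance {P : Channels N} {n : Fin N} {r : ℝ} {α : PMF (Finset (Fin N))}
    (hα : ∑ φ, (α φ).toReal * roundValue P n r φ = 0) {order : List (Fin N)}
    (hnd : order.Nodup) (hmem : ∀ n, n ∈ order) (M : ℕ) (rest : List (Fin N)) :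
    expect (advance α order M rest) (potential P n r) = restValue P n r M rest := by
  cases rest with
  | nil => rw [advance, expect_newRound hα hnd hmem]; rfl
  | cons m rest => rw [advance, expect_pure]; rfl

/-- A function of the phase ignores the new channel states and the new belief, which integrate out.
-/
theorem expect_step (P : Channels N) (α : PMF (Finset (Fin N))) (f : Phase N → ℝ)
    (x : (Fin N → Bool) × Control N) :
    expect (step P α x) (fun y => f y.2.phase) = expect (act P x.2) fun a =>
      expect (nextPhase α (nextOrder x.2.order a) x.2.phase a (a.feedback x.1)) f := by
  rw [step, expect_bind (finite_support_act _ _) fun _ =>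
    finite_support_bind (finite_support_nextControl _ _ _ _ _) fun _ =>
      finite_support_map _ (finite_support_coins _)]
  congr 1
  funext a
  rw [expect_bind (finite_support_nextControl _ _ _ _ _) fun _ =>
    finite_support_map _ (finite_support_coins _)]
  simp only [expect_map _ (finite_support_coins _), expect_const (finite_support_coins _)]
  rw [nextControl, expect_map _ (finite_support_nextPhase _ _ _ _ _)]

theorem served_data (n m : Fin N) (s : Fin N → Bool) :
    served n (s, Action.data m) = if m = n ∧ s m = true then 1 else 0 := by
  by_cases h : m = n
  · subst h
    rfl
  · simp [served, h]

theorem served_dummy (n m : Fin N) (s : Fin N → Bool) : served n (s, Action.dummy m) = 0 := rfl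

/-- The Poisson equation: under the conditional law of the channel states, the reward of a slot and
the next potential add up to `r` plus the present potential. -/
theorem potential_drift {P : Channels N} (hP : Admissible P) {n : Fin N} {r : ℝ}
    {α : PMF (Finset (Fin N))} (hα : ∑ φ, (α φ).toReal * roundValue P n r φ = 0)
    {c : Control N} (hc : Reachable P c) :
    expect (resample c) (fun x => expect (act P x.2) (fun a => served n (x.1, a)) +
      expect (step P α x) (fun y => potential P n r y.2.phase)) = r + potential P n r c.phase := by
  have hadv : ∀ (a : Action N) (M : ℕ) (rest : List (Fin N)),
      expect (advance α (nextOrder c.order a) M rest) (potential P n r) = restValue P n r M rest :=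
    fun a => expect_advance hα (nodup_nextOrder hc.nodup a) (mem_nextOrder hc.mem_order a)
  have hcoin : ∀ (m : Fin N) (G : Bool → ℝ), expect (coins c.belief) (fun s => G (s m)) =
      c.belief m * G true + (1 - c.belief m) * G false := fun m G => by
    rw [← expect_coin (hc.nonneg m) (hc.le_one m), ← map_coins,
      expect_map _ (finite_support_coins _)]
  rw [resample, expect_map _ (finite_support_coins _)]
  simp only [expect_step]
  cases hph : c.phase with
  | idle =>
    have hact : act P c = PMF.pure Action.idle := by simp [act, hph]
    simp only [hact, expect_pure, nextPhase, served,
      expect_newRound hα (nodup_nextOrder hc.nodup _) (mem_nextOrder hc.mem_order _),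
      expect_const (finite_support_coins _), potential]
    ring
  | turn M m rest =>
    have hact : act P c = (coin (kStep P m M false true / c.belief m)).map fun b =>
        if b then Action.data m else Action.dummy m := by simp [act, hph]
    have hk := hc.kStep_le_of_turn hph
    have hk0 := kStep_nonneg hP m M
    have hq := (hP.on_off_pos m).ne'
    set p := kStep P m M false true / c.belief m with hp
    have hp0 : 0 ≤ p := div_nonneg hk0 (hc.nonneg m)
    have hp1 : p ≤ 1 := div_le_one_of_le₀ hk (hc.nonneg m)
    -- The belief cancels here. If it is `0`, feasibility forces `P₀₁^(M) = 0` and the convention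
    -- `0/0 = 0` agrees.
    have hpw : p * c.belief m = kStep P m M false true := by
      rcases (hc.nonneg m).eq_or_lt with h | h
      · rw [← h] at hk ⊢
        rw [mul_zero]
        exact le_antisymm hk0 hk
      · exact div_mul_cancel₀ _ h.ne'
    let G : Bool → ℝ := fun b =>
      p * ((if m = n ∧ b = true then 1 else 0) + if b = true then potential P n r (Phase.hold M m rest)
        else restValue P n r M rest) + (1 - p) * restValue P n r M rest
    have hG : ∀ s : Fin N → Bool, expect (act P c) (fun a => served n (s, a)) +
        expect (act P c) (fun a => expect (nextPhase α (nextOrder c.order a) (Phase.turn M m rest) a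
          (a.feedback s)) (potential P n r)) = G (s m) := fun s => by
      simp only [hact, expect_map _ (Set.toFinite _), expect_coin hp0 hp1, if_true,
        Bool.false_eq_true, if_false, served_data, served_dummy, Action.feedback, Action.channel, Option.map_some]
      cases hs : s m
      · simp only [nextPhase, hadv, G]
        simp
      · simp only [nextPhase, hadv, G, expect_pure, and_true, if_true]
        ring
    simp only [hG, hcoin m G]
    simp only [G, potential, restValue, List.map_cons, List.sum_cons, turnValue,
      gain_eq_kStep_div hP, ← hpw]
    have h11 : P m true true = 1 - P m true false := by linarith [hP.row_sum m true]
    rw [h11]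
    by_cases hmn : m = n
    · simp only [hmn, true_and, if_true, Bool.false_eq_true, if_false]
      rw [hmn] at hq
      field_simp
      ring
    · simp only [hmn, false_and, if_true, Bool.false_eq_true, if_false]
      field_simp
      ring
  | hold M m rest =>
    have hact : act P c = PMF.pure (Action.data m) := by simp [act, hph]
    -- After an ACK the belief is exactly `P₁₁`, which makes the rest of the run geometric.
    have hω : c.belief m = P m true true := by
      have := hc.phaseOK
      rw [hph] at this
      exact this.1
    have hq := (hP.on_off_pos m).ne'
    let G : Bool → ℝ := fun b =>
      (if m = n ∧ b = true then 1 else 0) + if b = true then potential P n r (Phase.hold M m rest)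
        else restValue P n r M rest
    have hG : ∀ s : Fin N → Bool, expect (act P c) (fun a => served n (s, a)) +
        expect (act P c) (fun a => expect (nextPhase α (nextOrder c.order a) (Phase.hold M m rest) a
          (a.feedback s)) (potential P n r)) = G (s m) := fun s => by
      simp only [hact, expect_pure, served_data, Action.feedback, Action.channel, Option.map_some]
      cases hs : s m
      · simp only [nextPhase, hadv, G]
        simp
      · simp only [nextPhase, G, expect_pure]
        simp
    simp only [hG, hcoin m G]
    have h11 : P m true true = 1 - P m true false := by linarith [hP.row_sum m true]
    simp only [G, potential, hω, h11]
    by_cases hmn : m = n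
    · simp only [hmn, true_and, if_true, Bool.false_eq_true, if_false]
      rw [hmn] at hq
      field_simp
      ring
    · simp only [hmn, false_and, if_true, Bool.false_eq_true, if_false]
      field_simp
      ring

theorem abs_restValue_le (P : Channels N) (n : Fin N) (r : ℝ) {M : ℕ} {rest : List (Fin N)}
    (hnd : rest.Nodup) (hM : M ≤ N) :
    |restValue P n r M rest| ≤ ∑ M ∈ Finset.range (N + 1), ∑ k, |turnValue P n r M k| := by
  rw [restValue, ← List.sum_toFinset _ hnd]
  calc _ ≤ ∑ k ∈ rest.toFinset, |turnValue P n r M k| := Finset.abs_sum_le_sum_abs _ _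
    _ ≤ ∑ k, |turnValue P n r M k| :=
      Finset.sum_le_univ_sum_of_nonneg fun k => abs_nonneg _
    _ ≤ _ := Finset.single_le_sum (f := fun M => ∑ k, |turnValue P n r M k|)
      (fun _ _ => Finset.sum_nonneg fun _ _ => abs_nonneg _) (by simp; omega)

/-- The channels of a round form a duplicate-free list of length `M`, so `M ≤ N` and finitely many
terms dominate every reachable potential. -/
theorem exists_potential_bound (P : Channels N) (n : Fin N) (r : ℝ) :
    ∃ C, ∀ c, Reachable P c → |potential P n r c.phase| ≤ C := by
  refine ⟨|r| + ∑ m, |((if m = n then P m true true else 0) - r) / P m true false| +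
    ∑ M ∈ Finset.range (N + 1), ∑ k, |turnValue P n r M k|, fun c hc => ?_⟩
  have h1 : 0 ≤ ∑ m, |((if m = n then P m true true else 0) - r) / P m true false| :=
    Finset.sum_nonneg fun _ _ => abs_nonneg _
  have h2 : 0 ≤ ∑ M ∈ Finset.range (N + 1), ∑ k, |turnValue P n r M k| :=
    Finset.sum_nonneg fun _ _ => Finset.sum_nonneg fun _ _ => abs_nonneg _
  have h3 := abs_nonneg r
  have hok := hc.phaseOK
  have hlen : ∀ {l : List (Fin N)}, l.Sublist c.order → l.length ≤ N := fun hl => by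
    simpa using (hc.nodup.sublist hl).length_le_card
  cases hph : c.phase with
  | idle => simp only [potential, abs_neg]; linarith
  | turn M m rest =>
    rw [hph] at hok
    obtain ⟨done, hs, hl⟩ := hok
    have := abs_restValue_le P n r (M := M) (rest := m :: rest)
      (hc.nodup.sublist ((List.sublist_append_left _ _).trans hs)) (hl ▸ hlen hs)
    simp only [potential]
    linarith
  | hold M m rest =>
    rw [hph] at hok
    obtain ⟨-, done, hs, hl⟩ := hok
    have := abs_restValue_le P n r (M := M) (rest := rest)
      (hc.nodup.sublist ((List.sublist_append_left _ _).trans hs)) (hl ▸ hlen hs)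
    have h4 := Finset.single_le_sum
      (f := fun m => |((if m = n then P m true true else 0) - r) / P m true false|)
      (fun _ _ => abs_nonneg _) (Finset.mem_univ m)
    have h5 := abs_add_le (((if m = n then P m true true else 0) - r) / P m true false)
      (restValue P n r M rest)
    simp only [potential]
    linarith

/-! ### Throughput -/

theorem expServed_add_expect_potential {P : Channels N} (hP : Admissible P)
    {α : PMF (Finset (Fin N))} {n : Fin N} {r : ℝ}
    (hα : ∑ φ, (α φ).toReal * roundValue P n r φ = 0) {ω₀ : Fin N → ℝ} {order₀ : List (Fin N)}
    (hreach : ∀ t, ∀ x ∈ (law P α ω₀ order₀ t).support, Reachable P x.2) (t : ℕ) :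
    expServed P α ω₀ order₀ n t +
        expect (law P α ω₀ order₀ (t + 1)) (fun x => potential P n r x.2.phase) =
      r + expect (law P α ω₀ order₀ t) (fun x => potential P n r x.2.phase) := by
  have hfin := finite_support_law P α ω₀ order₀ t
  have h1 : expServed P α ω₀ order₀ n t =
      expect (law P α ω₀ order₀ t) fun x => expect (act P x.2) fun a => served n (x.1, a) := by
    change expect (slotLaw P α ω₀ order₀ t) (served n) = _
    rw [slotLaw, expect_bind hfin fun x => finite_support_map _ (finite_support_act P x.2)]
    simp only [expect_map _ (finite_support_act P _)]
  have h2 : expect (law P α ω₀ order₀ (t + 1)) (fun x => potential P n r x.2.phase) =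
      expect (law P α ω₀ order₀ t) fun x =>
        expect (step P α x) fun y => potential P n r y.2.phase :=
    expect_bind hfin (finite_support_step P α) _
  -- The Poisson equation holds only after averaging over channel states drawn from the beliefs, so
  -- a resampling is inserted first.
  have h3 : ∀ f : (Fin N → Bool) × Control N → ℝ, expect (law P α ω₀ order₀ t) f =
      expect (law P α ω₀ order₀ t) fun x => expect (resample x.2) f := fun f => by
    conv_lhs => rw [← law_bind_resample hP α hreach t]
    exact expect_bind hfin (fun x => finite_support_map _ (finite_support_coins _)) f
  rw [h1, h2, ← expect_add hfin, h3,
    expect_congr fun x hx => potential_drift hP hα (hreach t x hx),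
    expect_add hfin, expect_const hfin]

/-- Summing the Poisson equation over slots telescopes, leaving a bounded boundary term that
vanishes after division by `t`. -/
theorem hasThroughput {P : Channels N} (hP : Admissible P) {α : PMF (Finset (Fin N))}
    {lam : Fin N → ℝ} (hα : ∀ n, ∑ φ, (α φ).toReal * roundValue P n (lam n) φ = 0)
    {ω₀ : Fin N → ℝ} {order₀ : List (Fin N)}
    (hreach : ∀ t, ∀ x ∈ (law P α ω₀ order₀ t).support, Reachable P x.2) :
    HasThroughput P α ω₀ order₀ lam := by
  intro n
  obtain ⟨C, hC⟩ := exists_potential_bound P n (lam n)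
  let V : ℕ → ℝ := fun t =>
    expect (law P α ω₀ order₀ t) fun x => potential P n (lam n) x.2.phase
  have hV : ∀ t, |V t| ≤ C := fun t =>
    abs_expect_le (finite_support_law P α ω₀ order₀ t) fun x hx => hC x.2 (hreach t x hx)
  have hsum : ∀ t : ℕ, ∑ τ ∈ Finset.range t, expServed P α ω₀ order₀ n τ =
      t * lam n + (V 0 - V t) := fun t => by
    induction t with
    | zero => simp
    | succ t ih =>
      have h : expServed P α ω₀ order₀ n t + V (t + 1) = lam n + V t :=
        expServed_add_expect_potential hP (hα n) hreach t
      rw [Finset.sum_range_succ, ih]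
      push_cast
      linarith
  have hlim : Tendsto (fun t : ℕ => (1 / (t : ℝ)) * (V 0 - V t)) atTop (𝓝 0) := by
    refine squeeze_zero_norm (a := fun t : ℕ => (1 / (t : ℝ)) * (C + C)) (fun t => ?_) ?_
    · rw [norm_mul, Real.norm_of_nonneg (by positivity), Real.norm_eq_abs]
      gcongr
      exact (abs_sub _ _).trans (add_le_add (hV 0) (hV t))
    · simpa using tendsto_one_div_atTop_nhds_zero_nat.mul_const (C + C)
  have := hlim.const_add (lam n)
  rw [add_zero] at this
  refine this.congr' ?_
  filter_upwards [eventually_ne_atTop 0] with t ht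
  have ht' : (t : ℝ) ≠ 0 := by exact_mod_cast ht
  rw [hsum]
  field_simp

end
end RandRR

/-- The law of the rounds can be fixed before the initial data because the balance equation involves
only the gains, not the beliefs or the order. -/
theorem corollary2 {N : ℕ} (P : RandRR.Channels N) (hP : RandRR.Admissible P)
    (lam : Fin N → ℝ) (hlam : lam ∈ RandRR.lambdaInt P) :
    ∃ α : PMF (Finset (Fin N)),
      ∀ ω₀ : Fin N → ℝ, (∀ n, RandRR.kStep P n N false true ≤ ω₀ n ∧ ω₀ n ≤ 1) →
      ∀ order₀ : List (Fin N), order₀.Nodup → (∀ n, n ∈ order₀) →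
        RandRR.Feasible P α ω₀ order₀ ∧ RandRR.HasThroughput P α ω₀ order₀ lam := by
  obtain ⟨α, hα⟩ := RandRR.exists_round_distribution hP hlam
  refine ⟨α, fun ω₀ hω order₀ hnd hmem => ?_⟩
  have hreach := RandRR.reachable_of_mem_support_law hP α hω hnd hmem
  exact ⟨fun t x hx M n rest h => (hreach t x hx).kStep_le_of_turn h,
    RandRR.hasThroughput hP hα hreach⟩
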